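/- Let $I\subseteq\mathbb{R}$ be a nondegenerate interval (open, closed or half-open, bounded or unbounded). A sequence $(f_n\colon I\to\mathbb{R})_{n=1}^\infty$ of continuous functions with $f_1\le f_2\le\cdots$ pointwise on $I$ is called a max-family if $$\lim_{n\to\infty}\int_x^y f_n(t)\,dt=+\infty\qquad\text{for all }x,y\in I\text{ with }x<y,$$ and one puts $I_f:=\{x\in I:\lim_{n\to\infty}f_n(x)=+\infty\}$. Theorem. For every nondegenerate interval $I\subseteq\mathbb{R}$ and every $\theta\in[0,1]$ there exists a max-family $(f_n\colon I\to\mathbb{R})_{n=1}^\infty$ such that $$\dim_H(I_f\cap U)=\theta$$ for every nonempty subinterval $U$ of $I$ that is open in $I$ (in particular for every nonempty open interval $U\subseteq I$), where $\dim_H$ denotes the Hausdorff dimension. -/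

import Mathlib

open Set Filter MeasureTheory

namespace MaxFamily

/-- The set `I_f` of all points of `I` at which `f n` tends to `+∞`. -/
def infinitySet (I : Set ℝ) (f : ℕ → ℝ → ℝ) : Set ℝ :=
  {x | x ∈ I ∧ Tendsto (fun n => f n x) atTop atTop}

/-- `f` is a max-family on the interval `I`: a pointwise nondecreasing sequence of continuous
functions on `I` whose integrals over every nondegenerate `[x, y] ⊆ I` tend to `+∞`.
Only the values of `f n` on `I` matter. -/
structure IsMaxFamily (I : Set ℝ) (f : ℕ → ℝ → ℝ) : Prop where
  continuousOn : ∀ n, ContinuousOn (f n) I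
  le_succ : ∀ n, ∀ x ∈ I, f n x ≤ f (n + 1) x
  tendsto_integral : ∀ x ∈ I, ∀ y ∈ I, x < y →
    Tendsto (fun n => ∫ t in x..y, f n t) atTop atTop

/-- `U` is a nonempty subinterval of `I` that is open in the subspace topology of `I`. This covers
every nonempty open interval of `ℝ` contained in `I`, and also e.g. `[0, 1/2)` in `I = [0, 1]`. -/
structure IsOpenSubinterval (I U : Set ℝ) : Prop where
  nonempty : U.Nonempty
  ordConnected : U.OrdConnected
  relOpen : ∃ O : Set ℝ, IsOpen O ∧ U = I ∩ O

end MaxFamily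

/-! Any dense Gδ set is an infinity set. Write it as the intersection of decreasing dense open `O k`
and let `f n` be the sum over `k < n` of `w k` times a continuous function increasing in `n` to the
indicator of `O k`. With `1 ≤ w k`, the limit is infinite exactly on the intersection; with `w k`
large enough, the integrals diverge however small the `O k` are
(`exists_isMaxFamily_infinitySet_eq`). It remains to find a dense Gδ set of dimension `θ` in every
open set (`exists_isGδ_forall_dimH_inter_eq`). Small copies of a Cantor set of dimension `θ`, placed
at all rationals, form a countable union of dimension `θ`, and a Gδ hull does not raise the
dimension. -/

namespace MaxFamily

/-! ### Gδ hulls and Hausdorff dimension -/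

/-- A set of `d`-dimensional Hausdorff measure zero is contained in a Gδ set of measure zero. -/
theorem exists_isGδ_superset_hausdorffMeasure_eq_zero {X : Type*} [MetricSpace X]
    [MeasurableSpace X] [BorelSpace X] {d : ℝ} (hd : 0 < d) {s : Set X}
    (hs : Measure.hausdorffMeasure d s = 0) :
    ∃ G, s ⊆ G ∧ IsGδ G ∧ Measure.hausdorffMeasure d G = 0 := by
  have key : ∀ ε : NNReal, 0 < ε → ∃ t : ℕ → Set X, (∀ i, IsOpen (t i)) ∧ s ⊆ ⋃ i, t i ∧
      (∀ i, Metric.ediam (t i) ≤ 3 * ε) ∧ ∑' i, Metric.ediam (t i) ^ d ≤ 2 * ε := by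
    intro ε hε
    have hε' : (0 : ENNReal) < ε := by exact_mod_cast hε
    rw [Measure.hausdorffMeasure_apply, ENNReal.iSup_eq_zero] at hs
    have h1 := hs ε
    rw [ENNReal.iSup_eq_zero] at h1
    have h2 := h1 hε'
    -- The vanishing infimum lies below `ε`, which yields a cover of cost less than `ε`.
    rw [← h2] at hε'
    simp only [iInf_lt_iff] at hε'
    obtain ⟨t, hst, htε, hsum⟩ := hε'
    obtain ⟨e, he, hesum⟩ := ENNReal.exists_pos_sum_of_countable (ι := ℕ)
      (ε := (ε : ENNReal)) (by simpa using hε.ne')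
    have hδ : ∀ i, ∃ δ : NNReal, 0 < δ ∧ δ ≤ ε ∧
        (Metric.ediam (t i) + 2 * δ) ^ d ≤ Metric.ediam (t i) ^ d + e i := by
      intro i
      have hfin : Metric.ediam (t i) ≠ ⊤ := ((htε i).trans_lt ENNReal.coe_lt_top).ne
      have hcont : Tendsto (fun δ : NNReal => (Metric.ediam (t i) + 2 * (δ : ENNReal)) ^ d)
          (nhds 0) (nhds (Metric.ediam (t i) ^ d)) := by
        have h3 : Continuous fun δ : NNReal => (Metric.ediam (t i) + 2 * (δ : ENNReal)) ^ d := by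
          refine (ENNReal.continuous_rpow_const).comp ?_
          refine continuous_const.add ?_
          exact (ENNReal.continuous_const_mul (by simp)).comp ENNReal.continuous_coe
        simpa using h3.tendsto 0
      have hlt : Metric.ediam (t i) ^ d < Metric.ediam (t i) ^ d + e i :=
        ENNReal.lt_add_right (ENNReal.rpow_ne_top_of_nonneg hd.le hfin) (by simpa using (he i).ne')
      have h4 := (hcont.eventually (gt_mem_nhds hlt)).filter_mono
        (nhdsWithin_le_nhds (s := Ioi 0))
      have h5 : ∀ᶠ δ : NNReal in nhdsWithin 0 (Ioi 0), δ ≤ ε :=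
        nhdsWithin_le_nhds (Iic_mem_nhds hε)
      obtain ⟨δ, h6, h7, h8⟩ := (h4.and (h5.and self_mem_nhdsWithin)).exists
      exact ⟨δ, h8, h7, h6.le⟩
    choose δ hδ0 hδε hδ using hδ
    refine ⟨fun i => Metric.thickening (δ i) (t i), fun i => Metric.isOpen_thickening,
      hst.trans (iUnion_mono fun i => Metric.self_subset_thickening (by exact_mod_cast hδ0 i) _),
      fun i => ?_, ?_⟩
    · refine (Metric.ediam_thickening_le _).trans ?_
      have h9 : (δ i : ENNReal) ≤ ε := by exact_mod_cast hδε i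
      calc Metric.ediam (t i) + 2 * (δ i : ENNReal) ≤ ε + 2 * ε := by gcongr; exact htε i
        _ = 3 * ε := by ring
    · have h10 : ∀ i, Metric.ediam (Metric.thickening (δ i) (t i)) ^ d ≤
          (⨆ _ : (t i).Nonempty, Metric.ediam (t i) ^ d) + e i := by
        intro i
        rcases (t i).eq_empty_or_nonempty with h | h
        · simp [h, Metric.thickening_empty, hd]
        · simp only [h, iSup_pos]
          exact (ENNReal.rpow_le_rpow (Metric.ediam_thickening_le _) hd.le).trans (hδ i)
      calc _ ≤ ∑' i, ((⨆ _ : (t i).Nonempty, Metric.ediam (t i) ^ d) + (e i : ENNReal)) :=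
            ENNReal.tsum_le_tsum h10
        _ = _ := ENNReal.tsum_add
        _ ≤ (ε : ENNReal) + ε := add_le_add hsum.le hesum.le
        _ = 2 * ε := by ring
  have hpos : ∀ n : ℕ, (0 : NNReal) < 1 / ((n : NNReal) + 1) := fun n => by positivity
  choose t ht hst hdiam hsum using fun n : ℕ => key _ (hpos n)
  have hlim : Tendsto (fun n : ℕ => ((1 / ((n : NNReal) + 1) : NNReal) : ENNReal)) atTop
      (nhds 0) := by
    rw [← ENNReal.coe_zero]
    exact ENNReal.tendsto_coe.2 (tendsto_one_div_add_atTop_nhds_zero_nat (𝕜 := NNReal))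
  have hlim' : ∀ c : NNReal, Tendsto (fun n : ℕ => (c : ENNReal) *
      ((1 / ((n : NNReal) + 1) : NNReal) : ENNReal)) atTop (nhds 0) := fun c => by
    simpa using ENNReal.Tendsto.const_mul hlim (Or.inr (ENNReal.coe_ne_top (r := c)))
  refine ⟨⋂ n, ⋃ i, t n i, subset_iInter hst,
    IsGδ.iInter_of_isOpen fun n => isOpen_iUnion (ht n), ?_⟩
  refine le_antisymm ?_ zero_le
  refine (Measure.hausdorffMeasure_le_liminf_tsum d _ _ (hlim' 3) t
    (Eventually.of_forall fun n i => by simpa using hdiam n i)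
    (Eventually.of_forall fun n => iInter_subset _ n)).trans ?_
  rw [← (hlim' 2).liminf_eq]
  exact liminf_le_liminf (Eventually.of_forall fun n => by simpa using hsum n)

/-- A set of Hausdorff dimension at most `θ` is contained in a Gδ set of dimension at most `θ`. -/
theorem exists_isGδ_superset_dimH_le {X : Type*} [MetricSpace X] {s : Set X} {θ : NNReal}
    (hs : dimH s ≤ θ) : ∃ G, s ⊆ G ∧ IsGδ G ∧ dimH G ≤ θ := by
  borelize X
  -- The measure is known to vanish only for exponents above `θ`, hence one hull per exponent `θ + 1
  -- / (n + 1)`.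
  have h : ∀ n : ℕ, ∃ G, s ⊆ G ∧ IsGδ G ∧
      Measure.hausdorffMeasure ((θ + 1 / ((n : NNReal) + 1) : NNReal) : ℝ) G = 0 := by
    intro n
    have hpos : (0 : NNReal) < 1 / ((n : NNReal) + 1) := by positivity
    refine exists_isGδ_superset_hausdorffMeasure_eq_zero ?_
      (hausdorffMeasure_of_dimH_lt (hs.trans_lt ?_))
    · exact_mod_cast add_pos_of_nonneg_of_pos (zero_le (a := θ)) hpos
    · exact_mod_cast lt_add_of_pos_right θ hpos
  choose G hsG hG hG0 using h
  refine ⟨⋂ n, G n, subset_iInter hsG, IsGδ.iInter hG, ?_⟩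
  have hle : ∀ n : ℕ, dimH (⋂ n, G n) ≤ ((θ + 1 / ((n : NNReal) + 1) : NNReal) : ENNReal) := by
    intro n
    refine dimH_le_of_hausdorffMeasure_ne_top ?_
    rw [measure_mono_null (iInter_subset G n) (hG0 n)]
    exact ENNReal.zero_ne_top
  refine ge_of_tendsto' (x := atTop) (ENNReal.tendsto_coe.2 ?_) hle
  simpa using (tendsto_one_div_add_atTop_nhds_zero_nat (𝕜 := NNReal)).const_add θ

/-! ### Cantor sets of prescribed dimension -/

/-- The point with digits `a` in base `l⁻¹`. -/
noncomputable def digitSum (l : ℝ) (a : ℕ → Fin 2) : ℝ := ∑' i, ((a i : ℕ) : ℝ) * l ^ i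

section digitSum

variable {l : ℝ} (h0 : 0 < l) (h1 : l < 1)

include h0 h1

theorem summable_mul_pow_of_abs_le_one {c : ℕ → ℝ} (hc : ∀ i, |c i| ≤ 1) :
    Summable fun i => c i * l ^ i := by
  refine Summable.of_norm_bounded (summable_geometric_of_lt_one h0.le h1) fun i => ?_
  rw [norm_mul, Real.norm_eq_abs, Real.norm_of_nonneg (by positivity)]
  exact mul_le_of_le_one_left (by positivity) (hc i)

theorem abs_tsum_mul_pow_le {c : ℕ → ℝ} (hc : ∀ i, |c i| ≤ 1) {n : ℕ}
    (hn : ∀ i < n, c i = 0) : |∑' i, c i * l ^ i| ≤ l ^ n / (1 - l) := by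
  have hs := summable_mul_pow_of_abs_le_one h0 h1 hc
  rw [← hs.sum_add_tsum_nat_add n, Finset.sum_eq_zero fun i hi => by
    rw [hn i (Finset.mem_range.1 hi), zero_mul], zero_add, ← Real.norm_eq_abs, div_eq_mul_inv]
  refine tsum_of_norm_bounded ((hasSum_geometric_of_lt_one h0.le h1).mul_left (l ^ n))
    fun i => ?_
  rw [norm_mul, Real.norm_eq_abs, Real.norm_of_nonneg (by positivity), pow_add, mul_comm (l ^ i)]
  exact mul_le_of_le_one_left (by positivity) (hc _)

omit h0 h1 in
theorem abs_digit_sub_le_one (a b : Fin 2) : |((a : ℕ) : ℝ) - ((b : ℕ) : ℝ)| ≤ 1 := by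
  fin_cases a <;> fin_cases b <;> simp

theorem digitSum_sub_digitSum (a b : ℕ → Fin 2) : digitSum l a - digitSum l b =
    ∑' i, (((a i : ℕ) : ℝ) - ((b i : ℕ) : ℝ)) * l ^ i := by
  have h : ∀ a : ℕ → Fin 2, Summable fun i => ((a i : ℕ) : ℝ) * l ^ i := fun a =>
    summable_mul_pow_of_abs_le_one h0 h1 fun i => by
      simpa using abs_digit_sub_le_one (a i) 0
  rw [digitSum, digitSum, ← (h a).tsum_sub (h b)]
  simp only [sub_mul]

theorem abs_digitSum_sub_le {a b : ℕ → Fin 2} {n : ℕ} (h : ∀ i < n, a i = b i) :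
    |digitSum l a - digitSum l b| ≤ l ^ n / (1 - l) := by
  rw [digitSum_sub_digitSum h0 h1]
  exact abs_tsum_mul_pow_le h0 h1 (fun i => abs_digit_sub_le_one _ _) fun i hi => by simp [h i hi]

/-- The first differing digit contributes `l ^ n`; the later ones cancel at most `l ^ (n + 1) / (1 -
l)`. -/
theorem le_abs_digitSum_sub {a b : ℕ → Fin 2} {n : ℕ} (h : ∀ i < n, a i = b i) (hn : a n ≠ b n) :
    l ^ n * ((1 - 2 * l) / (1 - l)) ≤ |digitSum l a - digitSum l b| := by
  rw [digitSum_sub_digitSum h0 h1]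
  set c : ℕ → ℝ := fun i => ((a i : ℕ) : ℝ) - ((b i : ℕ) : ℝ) with hc
  have hc1 : ∀ i, |c i| ≤ 1 := fun i => abs_digit_sub_le_one _ _
  have hcn : |c n| = 1 := by
    have : ∀ x y : Fin 2, x ≠ y → |((x : ℕ) : ℝ) - ((y : ℕ) : ℝ)| = 1 := by
      intro x y hxy
      fin_cases x <;> fin_cases y <;> simp_all
    exact this _ _ hn
  have hs := summable_mul_pow_of_abs_le_one h0 h1 hc1
  set c' : ℕ → ℝ := fun i => if i = n then 0 else c i with hc'
  have htail : |∑' i, c' i * l ^ i| ≤ l ^ (n + 1) / (1 - l) := by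
    refine abs_tsum_mul_pow_le h0 h1 (fun i => ?_) fun i hi => ?_
    · by_cases hi : i = n
      · simp [hc', hi]
      · simpa [hc', hi] using hc1 i
    · by_cases hi' : i = n
      · simp [hc', hi']
      · simp [hc', hi', hc, h i (by omega)]
  have hsplit : ∑' i, c i * l ^ i = c n * l ^ n + ∑' i, c' i * l ^ i := by
    rw [hs.tsum_eq_add_tsum_ite n]
    congr 1
    refine tsum_congr fun i => ?_
    by_cases hi : i = n <;> simp [hc', hi]
  have h3 : |c n * l ^ n| = l ^ n := by rw [abs_mul, hcn, one_mul, abs_of_pos (by positivity)]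
  have h4 : 0 < 1 - l := by linarith
  calc l ^ n * ((1 - 2 * l) / (1 - l)) = l ^ n - l ^ (n + 1) / (1 - l) := by
        field_simp; ring
    _ ≤ |c n * l ^ n| - |∑' i, c' i * l ^ i| := by rw [h3]; linarith
    _ ≤ |c n * l ^ n + ∑' i, c' i * l ^ i| := by
        have := abs_sub_abs_le_abs_sub (c n * l ^ n) (-∑' i, c' i * l ^ i)
        rwa [abs_neg, sub_neg_eq_add] at this
    _ = _ := by rw [hsplit]

/-- The `2 ^ n` cylinders of length `n` have diameter of order `l ^ n`, and `2 ^ n * (l ^ n) ^ θ =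
1`. -/
theorem dimH_range_digitSum_le {θ : NNReal} (hθ : l ^ (θ : ℝ) = 1 / 2) :
    dimH (range (digitSum l)) ≤ θ := by
  have h4 : 0 < 1 - l := by linarith
  let t : ∀ n : ℕ, (Fin n → Fin 2) → Set ℝ := fun n w =>
    digitSum l '' {a | ∀ i : Fin n, a i = w i}
  have hdiam : ∀ n w, Metric.ediam (t n w) ≤ ENNReal.ofReal (l ^ n / (1 - l)) := by
    intro n w
    refine Metric.ediam_le ?_
    rintro _ ⟨a, ha, rfl⟩ _ ⟨b, hb, rfl⟩
    rw [edist_dist, Real.dist_eq]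
    exact ENNReal.ofReal_le_ofReal (abs_digitSum_sub_le h0 h1 fun i hi =>
      (ha ⟨i, hi⟩).trans (hb ⟨i, hi⟩).symm)
  have hlim : Tendsto (fun n : ℕ => ENNReal.ofReal (l ^ n / (1 - l))) atTop (nhds 0) := by
    rw [← ENNReal.ofReal_zero]
    refine ENNReal.tendsto_ofReal ?_
    simpa using (tendsto_pow_atTop_nhds_zero_of_lt_one h0.le h1).div_const (1 - l)
  have hsum : ∀ n, ∑ w, Metric.ediam (t n w) ^ (θ : ℝ) ≤
      ENNReal.ofReal ((1 / (1 - l)) ^ (θ : ℝ)) := by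
    intro n
    have hpow : (l ^ n) ^ (θ : ℝ) = (1 / 2) ^ n := by
      rw [← Real.rpow_natCast_mul h0.le, mul_comm, Real.rpow_mul_natCast h0.le, hθ]
    calc ∑ w, Metric.ediam (t n w) ^ (θ : ℝ)
        ≤ ∑ w : Fin n → Fin 2, ENNReal.ofReal (l ^ n / (1 - l)) ^ (θ : ℝ) :=
          Finset.sum_le_sum fun w _ => ENNReal.rpow_le_rpow (hdiam n w) θ.coe_nonneg
      _ = ENNReal.ofReal (2 ^ n * (l ^ n / (1 - l)) ^ (θ : ℝ)) := by
          rw [ENNReal.ofReal_rpow_of_nonneg (by positivity) θ.coe_nonneg, Finset.sum_const,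
            ENNReal.ofReal_mul (by positivity), nsmul_eq_mul, Finset.card_univ]
          simp [ENNReal.ofReal_pow]
      _ = ENNReal.ofReal ((1 / (1 - l)) ^ (θ : ℝ)) := by
          rw [div_eq_mul_one_div, Real.mul_rpow (by positivity) (by positivity), hpow,
            ← mul_assoc, ← mul_pow]
          norm_num
  refine dimH_le_of_hausdorffMeasure_ne_top (ne_top_of_le_ne_top ENNReal.ofReal_ne_top
    ((Measure.hausdorffMeasure_le_liminf_sum (θ : ℝ) _ _ hlim t
      (Eventually.of_forall hdiam) (Eventually.of_forall fun n => ?_)).trans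
      ((liminf_le_liminf (Eventually.of_forall hsum)).trans_eq (tendsto_const_nhds.liminf_eq))))
  rintro _ ⟨a, rfl⟩
  exact mem_iUnion.2 ⟨fun i => a i, a, fun i => rfl, rfl⟩

/-- Reading the same digits in base 2 is a `θ`-Hölder map onto a set containing `[0, 1]`, and such a
map multiplies dimension by at most `1 / θ`. -/
theorem le_dimH_range_digitSum (h2 : l < 1 / 2) {θ : NNReal} (hθ0 : 0 < θ)
    (hθ : l ^ (θ : ℝ) = 1 / 2) : θ ≤ dimH (range (digitSum l)) := by
  have h4 : 0 < 1 - l := by linarith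
  have h5 : 0 < 1 - 2 * l := by linarith
  set D : ℝ := (1 - l) / (1 - 2 * l)
  have hD : 0 < D := by positivity
  have key : ∀ a b : ℕ → Fin 2, |Real.ofDigits a - Real.ofDigits b| ≤
      D ^ (θ : ℝ) * |digitSum l a - digitSum l b| ^ (θ : ℝ) := by
    intro a b
    by_cases hab : a = b
    · subst hab; simp; positivity
    have hex : ∃ n, a n ≠ b n := Function.ne_iff.1 hab
    classical
    have hmin : ∀ i < Nat.find hex, a i = b i := fun i hi => not_not.1 (Nat.find_min hex hi)
    have hle := le_abs_digitSum_sub h0 h1 hmin (Nat.find_spec hex)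
    refine (Real.abs_ofDigits_sub_ofDigits_le hmin).trans ?_
    rw [← Real.mul_rpow hD.le (abs_nonneg _)]
    have hpow : (((2 : ℕ) : ℝ) ^ Nat.find hex)⁻¹ = (l ^ Nat.find hex) ^ (θ : ℝ) := by
      rw [← Real.rpow_natCast_mul h0.le, mul_comm, Real.rpow_mul_natCast h0.le, hθ]
      simp
    rw [hpow]
    refine Real.rpow_le_rpow (by positivity) ?_ θ.coe_nonneg
    calc l ^ Nat.find hex = D * (l ^ Nat.find hex * ((1 - 2 * l) / (1 - l))) := by
          rw [mul_left_comm, div_mul_div_cancel₀ h5.ne', div_self h4.ne', mul_one]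
      _ ≤ _ := by gcongr
  let g : ℝ → ℝ := fun x => Real.ofDigits (Function.invFun (digitSum l) x)
  have hinv : ∀ x ∈ range (digitSum l), digitSum l (Function.invFun (digitSum l) x) = x :=
    fun x hx => Function.invFun_eq hx
  have hg : HolderOnWith (D ^ (θ : ℝ)).toNNReal θ g (range (digitSum l)) := by
    intro x hx y hy
    have h := key (Function.invFun (digitSum l) x) (Function.invFun (digitSum l) y)
    rw [hinv x hx, hinv y hy] at h
    rw [edist_dist, edist_dist, Real.dist_eq, Real.dist_eq,
      ENNReal.ofReal_rpow_of_nonneg (abs_nonneg _) θ.coe_nonneg, ← ENNReal.ofReal,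
      ← ENNReal.ofReal_mul (by positivity)]
    exact ENNReal.ofReal_le_ofReal h
  have himage : Icc (0 : ℝ) 1 ⊆ g '' range (digitSum l) := by
    intro y hy
    obtain ⟨a, -, rfl⟩ := Real.ofDigits_SurjOn one_lt_two hy
    refine ⟨digitSum l a, mem_range_self a, ?_⟩
    have h := key (Function.invFun (digitSum l) (digitSum l a)) a
    rw [hinv _ (mem_range_self a), sub_self, abs_zero,
      Real.zero_rpow (by exact_mod_cast hθ0.ne'), mul_zero] at h
    exact sub_eq_zero.1 (abs_nonpos_iff.1 h)
  have hdim : (1 : ENNReal) ≤ dimH (range (digitSum l)) / θ := by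
    refine le_trans ?_ ((dimH_mono himage).trans (hg.dimH_image_le hθ0))
    rw [Real.dimH_of_nonempty_interior (by simp), Module.finrank_self, Nat.cast_one]
  have := ENNReal.mul_le_of_le_div hdim
  rwa [one_mul] at this

theorem isBounded_range_digitSum : Bornology.IsBounded (range (digitSum l)) := by
  refine Metric.isBounded_iff.2 ⟨1 / (1 - l), ?_⟩
  rintro _ ⟨a, rfl⟩ _ ⟨b, rfl⟩
  rw [Real.dist_eq]
  simpa using abs_digitSum_sub_le h0 h1 (a := a) (b := b) (n := 0) (by simp)

end digitSum

/-- Every `θ ∈ [0, 1]` is the Hausdorff dimension of a nonempty bounded set of reals. -/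
theorem exists_isBounded_dimH_eq {θ : NNReal} (hθ : θ ≤ 1) :
    ∃ C : Set ℝ, C.Nonempty ∧ Bornology.IsBounded C ∧ dimH C = θ := by
  rcases eq_or_ne θ 0 with rfl | h0
  · exact ⟨{0}, singleton_nonempty 0, Bornology.isBounded_singleton, by simp⟩
  rcases hθ.eq_or_lt with rfl | h1
  · refine ⟨Icc 0 1, by simp, Metric.isBounded_Icc 0 1, ?_⟩
    rw [Real.dimH_of_nonempty_interior (by simp), Module.finrank_self]
    simp
  have h0' : (0 : ℝ) < θ := by exact_mod_cast pos_iff_ne_zero.2 h0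
  have h1' : (θ : ℝ) < 1 := by exact_mod_cast h1
  -- This solves `l ^ θ = 1 / 2`; `θ < 1` gives `l < 1 / 2`, which separates the cylinders.
  set l : ℝ := (1 / 2) ^ (1 / (θ : ℝ))
  have hl0 : 0 < l := by positivity
  have hl : l < 1 / 2 := by
    have := Real.rpow_lt_rpow_of_exponent_gt (x := 1 / 2) (by norm_num) (by norm_num)
      (one_lt_one_div h0' h1')
    rwa [Real.rpow_one] at this
  have hlθ : l ^ (θ : ℝ) = 1 / 2 := by
    rw [← Real.rpow_mul (by norm_num), one_div_mul_cancel h0'.ne', Real.rpow_one]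
  exact ⟨range (digitSum l), range_nonempty _, isBounded_range_digitSum hl0 (by linarith),
    le_antisymm (dimH_range_digitSum_le hl0 (by linarith) hlθ)
      (le_dimH_range_digitSum hl0 (by linarith) hl (pos_iff_ne_zero.2 h0) hlθ)⟩

/-! ### A dense Gδ set of uniform local dimension -/

/-- Every `θ ∈ [0, 1]` is the local Hausdorff dimension, on all open sets, of some dense Gδ. -/
theorem exists_isGδ_forall_dimH_inter_eq {θ : NNReal} (hθ : θ ≤ 1) :
    ∃ G : Set ℝ, IsGδ G ∧ Dense G ∧
      dimH G ≤ θ ∧ ∀ U : Set ℝ, IsOpen U → U.Nonempty → θ ≤ dimH (G ∩ U) := by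
  obtain ⟨C, hCne, hC, hdim⟩ := exists_isBounded_dimH_eq hθ
  let F : Set ℝ := ⋃ p : ℕ × ℚ, (fun x => (1 / ((p.1 : ℝ) + 1)) • x + (p.2 : ℝ)) '' C
  have hanti : ∀ p : ℕ × ℚ, dimH ((fun x : ℝ => (1 / ((p.1 : ℝ) + 1)) • x + (p.2 : ℝ)) '' C) = θ := by
    intro p
    have hpos : 1 / ((p.1 : ℝ) + 1) ≠ 0 := by positivity
    have h1 : (fun x : ℝ => (1 / ((p.1 : ℝ) + 1)) • x + (p.2 : ℝ)) '' C =
        (IsometryEquiv.addRight (p.2 : ℝ)) ''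
          ((ContinuousLinearEquiv.smulLeft (R₁ := ℝ) (M₁ := ℝ) (Units.mk0 _ hpos)) '' C) := by
      rw [image_image]; rfl
    rw [h1, IsometryEquiv.dimH_image, ContinuousLinearEquiv.dimH_image, hdim]
  have hF : dimH F ≤ θ := by
    rw [dimH_iUnion]
    exact iSup_le fun p => (hanti p).le
  have hcopy : ∀ U : Set ℝ, IsOpen U → U.Nonempty → ∃ p : ℕ × ℚ,
      (fun x : ℝ => (1 / ((p.1 : ℝ) + 1)) • x + (p.2 : ℝ)) '' C ⊆ U := by
    rintro U hU ⟨x, hx⟩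
    obtain ⟨q, hq⟩ := Rat.denseRange_cast.exists_mem_open hU ⟨x, hx⟩
    obtain ⟨ε, hε, hball⟩ := Metric.isOpen_iff.1 hU q hq
    obtain ⟨R, hR⟩ := hC.exists_norm_le
    have hlim : Tendsto (fun n : ℕ => 1 / ((n : ℝ) + 1) * R) atTop (nhds 0) := by
      simpa using (tendsto_one_div_add_atTop_nhds_zero_nat (𝕜 := ℝ)).mul_const R
    obtain ⟨n, hn⟩ := (hlim.eventually (gt_mem_nhds hε)).exists
    refine ⟨(n, q), ?_⟩
    rintro _ ⟨y, hy, rfl⟩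
    refine hball ?_
    rw [Metric.mem_ball, dist_eq_norm, add_sub_cancel_right, norm_smul,
      Real.norm_of_nonneg (by positivity)]
    exact (mul_le_mul_of_nonneg_left (hR y hy) (by positivity)).trans_lt hn
  obtain ⟨G, hFG, hG, hdimG⟩ := exists_isGδ_superset_dimH_le hF
  refine ⟨G, hG, ?_, hdimG, fun U hU hUne => ?_⟩
  · refine dense_iff_inter_open.2 fun U hU hUne => ?_
    obtain ⟨p, hp⟩ := hcopy U hU hUne
    obtain ⟨y, hy⟩ := hCne.image fun x : ℝ => (1 / ((p.1 : ℝ) + 1)) • x + (p.2 : ℝ)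
    exact ⟨y, hp hy, hFG (mem_iUnion.2 ⟨p, hy⟩)⟩
  · obtain ⟨p, hp⟩ := hcopy U hU hUne
    rw [← hanti p]
    exact dimH_mono (subset_inter ((subset_iUnion _ p).trans hFG) hp)

/-! ### From dense Gδ sets to max-families -/

/-- Continuous functions increasing in `n` to the indicator of the open set `O`. -/
noncomputable def openApprox (O : Set ℝ) (n : ℕ) (x : ℝ) : ℝ :=
  1 - (thickenedIndicator (Nat.one_div_pos_of_nat (α := ℝ) (n := n)) Oᶜ x : ℝ)

theorem continuous_openApprox (O : Set ℝ) (n : ℕ) : Continuous (openApprox O n) := by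
  unfold openApprox
  fun_prop

theorem openApprox_nonneg (O : Set ℝ) (n : ℕ) (x : ℝ) : 0 ≤ openApprox O n x :=
  sub_nonneg.2 (by exact_mod_cast thickenedIndicator_le_one _ _ x)

theorem openApprox_le_one (O : Set ℝ) (n : ℕ) (x : ℝ) : openApprox O n x ≤ 1 :=
  sub_le_self _ NNReal.zero_le_coe

theorem openApprox_eq_zero {O : Set ℝ} {x : ℝ} (hx : x ∉ O) (n : ℕ) : openApprox O n x = 0 := by
  rw [openApprox, thickenedIndicator_one _ _ hx]
  simp

theorem openApprox_le_succ (O : Set ℝ) (n : ℕ) (x : ℝ) :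
    openApprox O n x ≤ openApprox O (n + 1) x :=
  sub_le_sub_left (by
    exact_mod_cast thickenedIndicator_mono _ _
      (by simpa using Nat.one_div_le_one_div (α := ℝ) n.le_succ) Oᶜ x) 1

theorem tendsto_openApprox {O : Set ℝ} (hO : IsOpen O) (x : ℝ) :
    Tendsto (fun n => openApprox O n x) atTop (nhds (O.indicator 1 x)) := by
  have h := tendsto_pi_nhds.1 (thickenedIndicator_tendsto_indicator_closure
    (fun n => Nat.one_div_pos_of_nat (α := ℝ) (n := n))
    (tendsto_one_div_add_atTop_nhds_zero_nat (𝕜 := ℝ)) Oᶜ) x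
  have h' := (NNReal.tendsto_coe.2 h).const_sub 1
  rw [hO.isClosed_compl.closure_eq] at h'
  convert! h' using 2
  by_cases hx : x ∈ O <;> simp [hx]

theorem tendsto_integral_openApprox {O : Set ℝ} (hO : IsOpen O) {x y : ℝ} (hxy : x ≤ y) :
    Tendsto (fun n => ∫ t in x..y, openApprox O n t) atTop
      (nhds (volume.real (O ∩ Ioc x y))) := by
  have h := intervalIntegral.tendsto_integral_filter_of_dominated_convergence
    (μ := volume) (a := x) (b := y) (l := atTop) (F := fun n t => openApprox O n t)
    (f := O.indicator 1) (fun _ => 1)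
    (Eventually.of_forall fun n => (continuous_openApprox O n).aestronglyMeasurable)
    (Eventually.of_forall fun n => Eventually.of_forall fun t _ => by
      rw [Real.norm_of_nonneg (openApprox_nonneg O n t)]
      exact openApprox_le_one O n t)
    intervalIntegrable_const
    (Eventually.of_forall fun t _ => tendsto_openApprox hO t)
  rwa [intervalIntegral.integral_of_le hxy, integral_indicator_one hO.measurableSet,
    measureReal_restrict_apply hO.measurableSet] at h

/-- Weights making the mass of `O k` at least one on each of the intervals
`J 0, …, J k`, where `J` enumerates the intervals with rational endpoints. -/
theorem exists_weights {O : ℕ → Set ℝ} (hO : ∀ k, IsOpen (O k)) (hd : ∀ k, Dense (O k)) :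
    ∃ w : ℕ → ℝ, (∀ k, 1 ≤ w k) ∧ ∀ x y : ℝ, x < y →
      ∀ᶠ k in atTop, 1 ≤ w k * volume.real (O k ∩ Ioc x y) := by
  obtain ⟨e, he⟩ := exists_surjective_nat (ℚ × ℚ)
  let m : ℕ → ℕ → ℝ := fun k j => volume.real (O k ∩ Ioc ((e j).1 : ℝ) (e j).2)
  have hm : ∀ k j, 0 ≤ 1 / m k j := fun k j => by positivity
  -- Degenerate rational intervals have `m k j = 0` and add `1 / 0 = 0`.
  refine ⟨fun k => 1 + ∑ j ∈ Finset.range (k + 1), 1 / m k j,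
    fun k => le_add_of_nonneg_right (Finset.sum_nonneg fun j _ => hm k j), fun x y hxy => ?_⟩
  obtain ⟨a, hxa, hay⟩ := exists_rat_btwn hxy
  obtain ⟨b, hab, hby⟩ := exists_rat_btwn hay
  obtain ⟨j, hj⟩ := he (a, b)
  filter_upwards [eventually_ge_atTop j] with k hk
  have hpos : 0 < m k j := by
    simp only [m, hj]
    refine ENNReal.toReal_pos ?_ (measure_ne_top_of_subset inter_subset_right (by simp))
    refine ne_of_gt (lt_of_lt_of_le ?_ (measure_mono (inter_subset_inter_right _ Ioo_subset_Ioc_self)))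
    refine ((hO k).inter isOpen_Ioo).measure_pos _ ?_
    rw [inter_comm]
    exact (hd k).inter_open_nonempty _ isOpen_Ioo (nonempty_Ioo.2 hab)
  have hle : m k j ≤ volume.real (O k ∩ Ioc x y) := by
    refine measureReal_mono (inter_subset_inter_right _ ?_)
      (measure_ne_top_of_subset inter_subset_right (by simp))
    simp only [hj]
    exact Ioc_subset_Ioc hxa.le hby.le
  have hw : 1 / m k j ≤ 1 + ∑ j ∈ Finset.range (k + 1), 1 / m k j :=
    (Finset.single_le_sum (f := fun j => 1 / m k j) (fun j _ => hm k j)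
      (Finset.mem_range.2 (Nat.lt_succ_of_le hk))).trans (le_add_of_nonneg_left zero_le_one)
  calc (1 : ℝ) = 1 / m k j * m k j := (one_div_mul_cancel hpos.ne').symm
    _ ≤ _ := mul_le_mul hw hle hpos.le ((hm k j).trans hw)

/-- A sequence of finite sums of functions with large limit values tends to infinity. -/
theorem tendsto_atTop_sum_range {a : ℕ → ℕ → ℝ} {c : ℕ → ℝ} (ha : ∀ k n, 0 ≤ a k n)
    (hlim : ∀ k, Tendsto (a k) atTop (nhds (c k))) (hc : ∀ᶠ k in atTop, 1 ≤ c k) :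
    Tendsto (fun n => ∑ k ∈ Finset.range n, a k n) atTop atTop := by
  have hc0 : ∀ k, 0 ≤ c k := fun k => ge_of_tendsto' (hlim k) (ha k)
  have hsum : Tendsto (fun N => ∑ k ∈ Finset.range N, c k) atTop atTop := by
    refine (not_summable_iff_tendsto_nat_atTop_of_nonneg hc0).1 fun hs => ?_
    obtain ⟨k, h1, h2⟩ := (hc.and (hs.tendsto_atTop_zero.eventually
      (gt_mem_nhds zero_lt_one))).exists
    exact h1.not_gt h2
  -- Finitely many limits already exceed `M`; the remaining terms are nonnegative.
  refine tendsto_atTop.2 fun M => ?_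
  obtain ⟨N, hN⟩ := (hsum.eventually_gt_atTop M).exists
  have hfin : Tendsto (fun n => ∑ k ∈ Finset.range N, a k n) atTop
      (nhds (∑ k ∈ Finset.range N, c k)) := tendsto_finsetSum _ fun k _ => hlim k
  filter_upwards [hfin.eventually (lt_mem_nhds hN), eventually_ge_atTop N] with n hn hNn
  exact hn.le.trans (Finset.sum_le_sum_of_subset_of_nonneg
    (Finset.range_subset_range.2 hNn) fun k _ _ => ha k n)

/-- Every dense Gδ set is the infinity set of a max-family. -/
theorem exists_isMaxFamily_infinitySet_eq {G : Set ℝ} (hG : IsGδ G) (hGd : Dense G) (I : Set ℝ) :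
    ∃ f : ℕ → ℝ → ℝ, IsMaxFamily I f ∧ infinitySet I f = I ∩ G := by
  obtain ⟨V, hV, hGV⟩ := isGδ_iff_eq_iInter_nat.1 hG
  -- Finite intersections make `O` decreasing, so a point outside `G` lies in only finitely many `O
  -- k`.
  let O : ℕ → Set ℝ := fun k => ⋂ j ∈ Iic k, V j
  have hO : ∀ k, IsOpen (O k) := fun k => (finite_Iic k).isOpen_biInter fun j _ => hV j
  have hGO : ∀ k, G ⊆ O k := fun k => by
    rw [hGV]
    exact subset_iInter₂ fun j _ => iInter_subset V j
  obtain ⟨w, hw1, hw⟩ := exists_weights hO fun k => hGd.mono (hGO k)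
  have hw0 : ∀ k, 0 ≤ w k := fun k => zero_le_one.trans (hw1 k)
  let f : ℕ → ℝ → ℝ := fun n x => ∑ k ∈ Finset.range n, w k * openApprox (O k) n x
  have hterm : ∀ k n x, 0 ≤ w k * openApprox (O k) n x := fun k n x =>
    mul_nonneg (hw0 k) (openApprox_nonneg _ _ _)
  have hcont : ∀ k n, Continuous fun x => w k * openApprox (O k) n x := fun k n =>
    continuous_const.mul (continuous_openApprox _ _)
  refine ⟨f, ⟨fun n => (continuous_finsetSum _ fun k _ => hcont k n).continuousOn,
    fun n x _ => ?_, fun x _ y _ hxy => ?_⟩, ?_⟩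
  · simp only [f, Finset.sum_range_succ _ n]
    exact le_add_of_le_of_nonneg (Finset.sum_le_sum fun k _ =>
      mul_le_mul_of_nonneg_left (openApprox_le_succ _ _ _) (hw0 k)) (hterm _ _ _)
  · have hint : ∀ n, ∫ t in x..y, f n t =
        ∑ k ∈ Finset.range n, w k * ∫ t in x..y, openApprox (O k) n t := fun n => by
      simp only [f]
      rw [intervalIntegral.integral_finsetSum fun k _ => (hcont k n).intervalIntegrable _ _]
      simp only [intervalIntegral.integral_const_mul]
    simp only [hint]
    exact tendsto_atTop_sum_range (fun k n => mul_nonneg (hw0 k)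
      (intervalIntegral.integral_nonneg hxy.le fun t _ => openApprox_nonneg _ _ _))
      (fun k => (tendsto_integral_openApprox (hO k) hxy.le).const_mul (w k)) (hw x y hxy)
  · ext x
    refine and_congr_right fun _ => ⟨fun h => ?_, fun hx => ?_⟩
    · by_contra hx
      obtain ⟨j, hj⟩ : ∃ j, x ∉ V j := by simpa [hGV] using hx
      have hzero : ∀ k, j ≤ k → x ∉ O k := fun k hk hxO => hj (mem_iInter₂.1 hxO j hk)
      have hbound : ∀ n, f n x ≤ ∑ k ∈ Finset.range j, w k := by
        intro n
        calc f n x ≤ ∑ k ∈ Finset.range n, if k < j then w k else 0 := by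
              refine Finset.sum_le_sum fun k _ => ?_
              split_ifs with hk
              · exact mul_le_of_le_one_right (hw0 k) (openApprox_le_one _ _ _)
              · rw [openApprox_eq_zero (hzero k (not_lt.1 hk)), mul_zero]
          _ = ∑ k ∈ Finset.range n with k < j, w k := (Finset.sum_filter _ _).symm
          _ ≤ _ := Finset.sum_le_sum_of_subset_of_nonneg
              (fun k hk => Finset.mem_range.2 (Finset.mem_filter.1 hk).2) fun k _ _ => hw0 k
      obtain ⟨n, hn⟩ := (h.eventually_gt_atTop _).exists
      exact (hbound n).not_gt hn
    · refine tendsto_atTop_sum_range (fun k n => hterm k n x)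
        (fun k => (tendsto_openApprox (hO k) x).const_mul (w k)) (Eventually.of_forall fun k => ?_)
      simpa [indicator_of_mem (hGO k hx)] using hw1 k

/-- A nonempty relatively open subset of a nondegenerate interval has nonempty interior. -/
theorem IsOpenSubinterval.interior_nonempty {I U : Set ℝ} (hI : I.OrdConnected)
    (hI' : I.Nontrivial) (hU : IsOpenSubinterval I U) : (interior U).Nonempty := by
  obtain ⟨O, hO, rfl⟩ := hU.relOpen
  obtain ⟨x, hxI, hxO⟩ := hU.nonempty
  -- The point may be an endpoint of `I`, but it is still a limit of interior points.
  have hcl : x ∈ closure (interior I) := by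
    rw [(convex_iff_ordConnected (𝕜 := ℝ) |>.2 hI).closure_interior_eq_closure_of_nonempty_interior
      ((convex_iff_ordConnected (𝕜 := ℝ) |>.2 hI).nontrivial_iff_nonempty_interior.1 hI')]
    exact subset_closure hxI
  rw [interior_inter, hO.interior_eq, inter_comm]
  exact mem_closure_iff.1 hcl O hO hxO

end MaxFamily

theorem mainTheorem2 (I : Set ℝ) (hI : I.OrdConnected) (hI' : I.Nontrivial)
    (θ : ℝ) (hθ : θ ∈ Set.Icc (0 : ℝ) 1) :
    ∃ f : ℕ → ℝ → ℝ, MaxFamily.IsMaxFamily I f ∧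
      ∀ U : Set ℝ, MaxFamily.IsOpenSubinterval I U →
        dimH (MaxFamily.infinitySet I f ∩ U) = ENNReal.ofReal θ := by
  obtain ⟨G, hG, hGd, hle, hge⟩ :=
    MaxFamily.exists_isGδ_forall_dimH_inter_eq (Real.toNNReal_le_one.2 hθ.2)
  obtain ⟨f, hf, hfG⟩ := MaxFamily.exists_isMaxFamily_infinitySet_eq hG hGd I
  refine ⟨f, hf, fun U hU => le_antisymm ?_ ?_⟩
  · refine (dimH_mono ?_).trans hle
    rw [hfG]
    exact inter_subset_left.trans inter_subset_right
  · refine (hge _ isOpen_interior (hU.interior_nonempty hI hI')).trans (dimH_mono ?_)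
    have hUI : U ⊆ I := by
      obtain ⟨O, -, rfl⟩ := hU.relOpen
      exact inter_subset_left
    rw [hfG]
    exact fun x hx => ⟨⟨hUI (interior_subset hx.2), hx.1⟩, interior_subset hx.2⟩
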